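/- Fix an embedding dimension $d\in\mathbb N$, a temperature $\tau>0$ and a real $M$. There are $D_0\in\mathbb N$, $K\in\mathbb R$, real sequences $a_0(D),a_1(D),a_2(D)$ that tend to $0$ as $D\to\infty$ (terms $o_D(1)$) and real sequences $b_1(m),b_2(m)$ that are $o(1/m)$ as $m\to\infty$, all depending only on $d,\tau,M$, such that the following holds for all $D\ge D_0$. Let $n\ge 2$ be the number of classes, $t\in[n]$ the true class, and $\mathcal N_t=[n]\setminus\{t\}$. Let the input embedding $\mathbf h(\theta)\in\mathbb R^d$ and the class embeddings $\mathbf c_1(\theta),\dots,\mathbf c_n(\theta)\in\mathbb R^d$ depend on a parameter $\theta\in\mathbb R^P$. At the $\theta$ considered, assume that they are $\ell_2$-normalized, that the logits $o_i=\tau\,\mathbf h^T\mathbf c_i$ are differentiable in $\theta$, and that all coordinates of the gradients $\nabla_\theta o_i$ are bounded by $M$ in absolute value. Let $\mathcal L=-o_t+\log\sum_{i=1}^n e^{o_i}$ be the full softmax loss. Given a sampling distribution $q$ on $\mathcal N_t$ and i.i.d. samples $s_1,\dots,s_m\sim q$, let $$\nabla_\theta\mathcal L'=-\nabla_\theta o_t+\frac{e^{o_t}\nabla_\theta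 o_t+\sum_{i=1}^m\frac{e^{o_{s_i}}}{mq_{s_i}}\nabla_\theta o_{s_i}}{e^{o_t}+\sum_{i=1}^m\frac{e^{o_{s_i}}}{mq_{s_i}}}$$ be the sampled softmax gradient estimate. Let $\mathbf w_1,\dots,\mathbf w_D$ be i.i.d. $N(0,\nu\mathbf I)$ in $\mathbb R^d$ with $\nu=\tau$, and let $$\phi(\mathbf u)=\tfrac1{\sqrt D}\big[\cos(\mathbf w_1^T\mathbf u),\dots,\cos(\mathbf w_D^T\mathbf u),\sin(\mathbf w_1^T\mathbf u),\dots,\sin(\mathbf w_D^T\mathbf u)\big]$$ be the random Fourier feature map. Let $q_i=\phi(\mathbf c_i)^T\phi(\mathbf h)/C$ for $i\in\mathcal N_t$, with $C=\sum_{j\in\mathcal N_t}\phi(\mathbf c_j)^T\phi(\mathbf h)$ (RF-softmax). Then, with probability at least $1-K/D^2$ over $\mathbf w_1,\dots,\mathbf w_D$, the vector $q$ is a strictly positive probability distribution on $\mathcal N_t$ and, for all $m\ge1$, $$-a_0(D)\cdot\mathbf 1\ \le\ \mathbb E[\nabla_\theta\mathcal L']-\nabla_\theta\mathcal L\ \le\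 \big(a_1(D)+b_1(m)\big)\cdot\mathbf g+\big(a_2(D)+b_2(m)\big)\cdot\mathbf 1$$ coordinatewise, where $\mathbf g=\sum_{j\in\mathcal N_t}e^{o_j}\nabla_\theta o_j$, $\mathbf 1$ is the all-one vector, and the expectation is over $s_1,\dots,s_m$ drawn i.i.d. from $q$. -/

import Mathlib

open Filter Topology MeasureTheory ProbabilityTheory Asymptotics

namespace RFSoftmax

noncomputable section

/-- Real Euclidean space of dimension `k`, with the `ℓ²` norm. -/
abbrev Vec (k : ℕ) : Type := EuclideanSpace ℝ (Fin k)

/-- The logit `τ hᵀ c` of a class with embedding `c`, for the input embedding `h`. -/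
def logit {d : ℕ} (τ : ℝ) (h c : Vec d) : ℝ := τ * inner ℝ h c

/-- The full softmax cross-entropy loss `-o_t + log Z`, `Z = ∑ i, exp (o_i)`. -/
def fullLoss {n : ℕ} (t : Fin n) (o : Fin n → ℝ) : ℝ :=
  -o t + Real.log (∑ i, Real.exp (o i))

/-- The set `[n] \ {t}` of negative classes. -/
abbrev Neg {n : ℕ} (t : Fin n) : Type := {i : Fin n // i ≠ t}

/-- The sampled softmax gradient estimate built from the logits `o`, the gradients `G i` of the
logits, the sampling distribution `q` and the sampled negative classes `s 0, …, s (m - 1)`: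
`-G_t + (e^{o_t} G_t + ∑ i, e^{o_{s_i}} / (m q_{s_i}) G_{s_i}) / (e^{o_t} + ∑ i, e^{o_{s_i}} / (m q_{s_i}))`.
-/
def sampledGrad {n P m : ℕ} (t : Fin n) (o : Fin n → ℝ) (G : Fin n → Vec P)
    (q : Neg t → ℝ) (s : Fin m → Neg t) : Vec P :=
  -G t +
    (Real.exp (o t) + ∑ i, Real.exp (o (s i)) / (m * q (s i)))⁻¹ •
      (Real.exp (o t) • G t + ∑ i, (Real.exp (o (s i)) / (m * q (s i))) • G (s i))

/-- The expectation of the sampled softmax gradient estimate when `s 0, …, s (m - 1)` are drawn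
independently from the probability distribution `q` on the negative classes. -/
def expectedSampledGrad {n P : ℕ} (m : ℕ) (t : Fin n) (o : Fin n → ℝ) (G : Fin n → Vec P)
    (q : Neg t → ℝ) : Vec P :=
  ∑ s : Fin m → Neg t, (∏ i, q (s i)) • sampledGrad t o G q s

/-- `q` is a probability distribution giving positive mass to every point. -/
def IsPosDistribution {ι : Type} [Fintype ι] (q : ι → ℝ) : Prop :=
  (∀ i, 0 < q i) ∧ ∑ i, q i = 1

/-- The random Fourier feature map with frequencies `w 0, …, w (D - 1)`:
`φ(u) = D^{-1/2} [cos (w_jᵀ u), …, sin (w_jᵀ u), …]`. -/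
def rffMap {d D : ℕ} (w : Fin D → Vec d) (u : Vec d) : EuclideanSpace ℝ (Fin D ⊕ Fin D) :=
  (1 / Real.sqrt D) • WithLp.toLp 2
    (Sum.elim (fun j => Real.cos (inner ℝ (w j) u)) (fun j => Real.sin (inner ℝ (w j) u)))

/-- The RF-softmax sampling probabilities `q_i = φ(c_i)ᵀ φ(h) / C` on the negative classes,
where `C` is the sum of `φ(c_j)ᵀ φ(h)` over all negative classes `j`. -/
def rfSoftmax {n d D : ℕ} (t : Fin n) (w : Fin D → Vec d) (h : Vec d) (c : Fin n → Vec d) :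
    Neg t → ℝ :=
  fun i => inner ℝ (rffMap w (c i)) (rffMap w h) /
    ∑ j : Neg t, inner ℝ (rffMap w (c j)) (rffMap w h)

/-- The joint law of `D` independent frequencies with distribution `N(0, ν I)` on `ℝ^d`: the
frequencies used for the Gaussian kernel `exp (-ν ‖x - y‖² / 2)`. -/
def freqLaw (d D : ℕ) (ν : ℝ) : Measure (Fin D → Vec d) :=
  Measure.pi fun _ => multivariateGaussian 0 (ν • (1 : Matrix (Fin d) (Fin d) ℝ))

end

end RFSoftmax

/-!
For unit vectors the logits satisfy `e^{o_i} = e^τ κ(c_i - h)`, where `κ(u) = e^{-τ ‖u‖² / 2}` is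
the Gaussian kernel, and the random feature kernel is the empirical mean of `cos (w_jᵀ u)`, whose
expectation under `N(0, τ I)` is `κ(u)`. So RF-softmax samples almost from the softmax distribution
itself.

*Uniform approximation.* Outside an event of probability `O(1/D²)`, the random feature kernel is
within `kernelError = o(1)` of `κ` on the whole ball of radius `2`
(`exists_measure_kernelError_lt_le`). This is Hoeffding's inequality on a grid with `O(D^{3d})`
points; between grid points the error is controlled by the Lipschitz constant `D⁻¹ ∑ ‖w_j‖`, which
exceeds `D²` with probability at most `O(1/D²)` by Markov's inequality. As the bound is uniform over
the ball, it does not depend on the number of classes.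

*Importance weights.* Since `κ ≥ e^{-2τ}` on that ball, the additive error is a relative error, and
all importance weights `e^{o_i} / q_i` are within relative error `δ_D = o(1)` of the partition
function `Z` of the negative classes (`importance_weight_bound`).

*Bias.* Write the sampled gradient as `-G_t + N / (A + S)`, with `A = e^{o_t}` and `S` the mean of
the importance weights, and write `∇L'` and `∇L` for the sampled and the full gradient. Then
`|S - Z| ≤ δ_D Z` for every sample, while `|N| ≤ M (A + S)`, so replacing `S` by `Z` in the
denominator costs at most `M δ_D`; after this replacement the estimate is linear in the sample and
exactly unbiased (`sum_prod_mul_importance_sum`). Hence `|E[∇L'] - ∇L| ≤ M δ_D` in every coordinate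
and for every `m` (`abs_expectedSampledGrad_sub_le`). This two-sided bound implies the claim, with
vanishing coefficient of `g` and vanishing terms in `m`.
-/

namespace RFSoftmax

/-! ### Random Fourier features and the Gaussian kernel -/

/-- The random Fourier feature kernel is an empirical mean of cosines of `u - v`. -/
theorem inner_rffMap {d D : ℕ} (w : Fin D → Vec d) (u v : Vec d) :
    inner ℝ (rffMap w u) (rffMap w v) = (∑ j, Real.cos (inner ℝ (w j) (u - v))) / D := by
  have hD : (1 / Real.sqrt D) * (1 / Real.sqrt D) = 1 / (D : ℝ) := by
    rw [div_mul_div_comm, Real.mul_self_sqrt (Nat.cast_nonneg D), one_mul]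
  simp only [rffMap, inner_smul_left, inner_smul_right, PiLp.inner_apply,
    Fintype.sum_sum_type, Sum.elim_inl, Sum.elim_inr, ← mul_assoc, inner_sub_right, Real.cos_sub,
    Finset.sum_add_distrib, RCLike.inner_apply, conj_trivial, hD]
  simp only [mul_comm, div_eq_mul_inv, mul_one]

theorem integral_cos_inner_multivariateGaussian (d : ℕ) {τ : ℝ} (hτ : 0 ≤ τ) (u : Vec d) :
    ∫ w, Real.cos (inner ℝ w u) ∂multivariateGaussian 0 (τ • (1 : Matrix (Fin d) (Fin d) ℝ)) =
      Real.exp (-(τ * ‖u‖ ^ 2) / 2) := by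
  have hS : (τ • (1 : Matrix (Fin d) (Fin d) ℝ)).PosSemidef := Matrix.PosSemidef.one.smul hτ
  have h := charFun_multivariateGaussian (μ := 0) hS u
  have hu : u.ofLp ⬝ᵥ (τ • (1 : Matrix (Fin d) (Fin d) ℝ)).mulVec u.ofLp = τ * ‖u‖ ^ 2 := by
    rw [Matrix.smul_mulVec, Matrix.one_mulVec, dotProduct_smul, EuclideanSpace.real_norm_sq_eq]
    simp [dotProduct, sq]
  rw [hu, charFun_apply] at h
  have hint : Integrable (fun w : Vec d => Complex.exp (inner ℝ w u * Complex.I))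
      (multivariateGaussian 0 (τ • (1 : Matrix (Fin d) (Fin d) ℝ))) := by
    refine Integrable.of_bound (by fun_prop) 1 (Eventually.of_forall fun w => ?_)
    rw [Complex.norm_exp_ofReal_mul_I]
  have h2 := integral_re hint
  simp only [RCLike.re_to_complex, Complex.exp_ofReal_mul_I_re] at h2
  rw [h2, h]
  simp only [inner_zero_right, Complex.ofReal_zero, zero_mul, zero_sub]
  rw [← Complex.exp_ofReal_re]
  congr 2
  push_cast
  ring

/-! ### The bias of the sampled softmax gradient -/

theorem sum_prod_apply_eq_one {ι : Type*} [Fintype ι] {q : ι → ℝ} (hq : ∑ a, q a = 1) (m : ℕ) :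
    ∑ s : Fin m → ι, ∏ i, q (s i) = 1 := by
  classical
  rw [← Fintype.piFinset_univ, ← Finset.prod_univ_sum]
  simp [hq]

/-- Under the product weights `∏ i, q (s i)` each coordinate `s j` has distribution `q`. -/
theorem sum_prod_apply_mul {ι : Type*} [Fintype ι] {q : ι → ℝ} (hq : ∑ a, q a = 1) {m : ℕ}
    (j : Fin m) (f : ι → ℝ) :
    ∑ s : Fin m → ι, (∏ i, q (s i)) * f (s j) = ∑ a, q a * f a := by
  classical
  have h : ∀ s : Fin m → ι, (∏ i, q (s i)) * f (s j) =
      ∏ i, (q (s i) * if i = j then f (s i) else 1) := by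
    intro s
    rw [Finset.prod_mul_distrib]
    simp
  simp only [h]
  rw [← Fintype.piFinset_univ,
    ← Finset.prod_univ_sum (fun _ : Fin m => (Finset.univ : Finset ι))
      (fun i a => q a * if i = j then f a else 1),
    Finset.prod_eq_single j]
  · simp
  · intro i _ hij
    simp [hij, hq]
  · simp

/-- Importance sampling is unbiased: the mean of the numerators is the full weighted sum. -/
theorem sum_prod_mul_importance_sum {ι : Type*} [Fintype ι] {q : ι → ℝ} (hpos : ∀ a, 0 < q a)
    (hq : ∑ a, q a = 1) {m : ℕ} (hm : 1 ≤ m) (e x : ι → ℝ) :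
    ∑ s : Fin m → ι, (∏ i, q (s i)) * ∑ i, e (s i) / (m * q (s i)) * x (s i) =
      ∑ a, e a * x a := by
  have hm0 : (m : ℝ) ≠ 0 := by positivity
  simp only [Finset.mul_sum]
  rw [Finset.sum_comm]
  have h (i : Fin m) := sum_prod_apply_mul hq i (fun a => e a / (m * q a) * x a)
  simp only [h, Finset.sum_const, Finset.card_univ, Fintype.card_fin, nsmul_eq_mul]
  rw [Finset.mul_sum]
  refine Finset.sum_congr rfl fun a _ => ?_
  have := (hpos a).ne'
  field_simp

/-- A weighted average of numbers in `[-M, M]` changes by at most `M δ` when its normalizing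
constant `A + S` is replaced by `A + Z` and `S` is within relative error `δ` of `Z`. -/
theorem abs_div_sub_div_le {A S Z N M δ : ℝ} (hA : 0 < A) (hS : 0 ≤ S) (hZ : 0 ≤ Z) (hM : 0 ≤ M)
    (hδ : 0 ≤ δ) (hN : |N| ≤ M * (A + S)) (hSZ : |S - Z| ≤ δ * Z) :
    |N / (A + S) - N / (A + Z)| ≤ M * δ := by
  have h1 : 0 < A + S := by linarith
  have h2 : 0 < A + Z := by linarith
  have : N / (A + S) - N / (A + Z) = N * (Z - S) / ((A + S) * (A + Z)) := by
    field_simp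
    ring
  rw [this, abs_div, abs_mul, abs_of_pos (mul_pos h1 h2), div_le_iff₀ (mul_pos h1 h2), abs_sub_comm]
  calc |N| * |S - Z| ≤ (M * (A + S)) * (δ * Z) := by gcongr
    _ ≤ (M * (A + S)) * (δ * (A + Z)) := by gcongr; linarith
    _ = _ := by ring

/-- If all importance weights `e^{o_i} / q_i` are within relative error `δ` of the partition
function of the negative classes, then the bias of the sampled softmax gradient is at most `M δ` in
every coordinate, for every sample size. -/
theorem abs_expectedSampledGrad_sub_le {n P m : ℕ} {t : Fin n} {o : Fin n → ℝ} {G : Fin n → Vec P}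
    {q : Neg t → ℝ} (hq : IsPosDistribution q) (hm : 1 ≤ m) {k : Fin P} {M δ : ℝ} (hδ : 0 ≤ δ)
    (hG : ∀ i, |G i k| ≤ M)
    (hw : ∀ i : Neg t, |Real.exp (o i) / q i - ∑ j : Neg t, Real.exp (o j)| ≤
      δ * ∑ j : Neg t, Real.exp (o j)) :
    |expectedSampledGrad m t o G q k - (-G t k +
      (Real.exp (o t) * G t k + ∑ j : Neg t, Real.exp (o j) * G j k) /
        (Real.exp (o t) + ∑ j : Neg t, Real.exp (o j)))| ≤ M * δ := by
  set Z := ∑ j : Neg t, Real.exp (o j) with hZ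
  set A := Real.exp (o t) with hA
  have hApos : 0 < A := Real.exp_pos _
  have hZnn : 0 ≤ Z := Finset.sum_nonneg fun j _ => (Real.exp_pos _).le
  have hM : 0 ≤ M := (abs_nonneg _).trans (hG t)
  have hm0 : (0 : ℝ) < m := by exact_mod_cast hm
  obtain ⟨hpos, hsum⟩ := hq
  set S : (Fin m → Neg t) → ℝ := fun s => ∑ i, Real.exp (o (s i)) / (m * q (s i)) with hSdef
  set N : (Fin m → Neg t) → ℝ := fun s =>
    A * G t k + ∑ i, Real.exp (o (s i)) / (m * q (s i)) * G (s i) k with hNdef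
  have hwt : ∀ (s : Fin m → Neg t) i, 0 < Real.exp (o (s i)) / (m * q (s i)) := fun s i =>
    div_pos (Real.exp_pos _) (mul_pos hm0 (hpos _))
  have hE : expectedSampledGrad m t o G q k =
      ∑ s : Fin m → Neg t, (∏ i, q (s i)) * (-G t k + N s / (A + S s)) := by
    simp [expectedSampledGrad, sampledGrad, hNdef, hSdef, hA, div_eq_inv_mul, mul_add]
  have hT : -G t k + (A * G t k + ∑ j : Neg t, Real.exp (o j) * G j k) / (A + Z) =
      ∑ s : Fin m → Neg t, (∏ i, q (s i)) * (-G t k + N s / (A + Z)) := by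
    simp only [mul_add, Finset.sum_add_distrib, ← Finset.sum_mul, sum_prod_apply_eq_one hsum,
      one_mul, mul_div_assoc', ← Finset.sum_div, hNdef,
      sum_prod_mul_importance_sum hpos hsum hm (fun a : Neg t => Real.exp (o a))
        (fun a : Neg t => G a k)]
  rw [hE, hT, ← Finset.sum_sub_distrib]
  have hterm : ∀ s : Fin m → Neg t, |(∏ i, q (s i)) * (-G t k + N s / (A + S s)) -
      (∏ i, q (s i)) * (-G t k + N s / (A + Z))| ≤ (∏ i, q (s i)) * (M * δ) := by
    intro s
    have hp : 0 ≤ ∏ i, q (s i) := Finset.prod_nonneg fun i _ => (hpos _).le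
    rw [← mul_sub, abs_mul, abs_of_nonneg hp, add_sub_add_left_eq_sub]
    refine mul_le_mul_of_nonneg_left ?_ hp
    refine abs_div_sub_div_le hApos (Finset.sum_nonneg fun i _ => (hwt s i).le) hZnn hM hδ ?_ ?_
    · calc |N s| ≤ |A * G t k| + ∑ i, |Real.exp (o (s i)) / (m * q (s i)) * G (s i) k| :=
            (abs_add_le _ _).trans (add_le_add_right (Finset.abs_sum_le_sum_abs _ _) _)
        _ ≤ A * M + ∑ i, Real.exp (o (s i)) / (m * q (s i)) * M := by
            refine add_le_add ?_ (Finset.sum_le_sum fun i _ => ?_)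
            · rw [abs_mul, abs_of_pos hApos]
              gcongr
              exact hG t
            · rw [abs_mul, abs_of_pos (hwt s i)]
              exact mul_le_mul_of_nonneg_left (hG _) (hwt s i).le
        _ = M * (A + S s) := by
            rw [← Finset.sum_mul]
            ring
    · -- `S s` is the mean of the `m` importance weights, each of them close to `Z`.
      have hS : S s - Z = (∑ i, (Real.exp (o (s i)) / q (s i) - Z)) / m := by
        rw [Finset.sum_sub_distrib, sub_div, Finset.sum_div]
        simp only [Finset.sum_const, Finset.card_univ, Fintype.card_fin, nsmul_eq_mul, hSdef]
        congr 1
        · refine Finset.sum_congr rfl fun i _ => ?_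
          rw [div_div, mul_comm]
        · field_simp
      rw [hS, abs_div, abs_of_pos hm0, div_le_iff₀ hm0]
      calc _ ≤ ∑ i, |Real.exp (o (s i)) / q (s i) - Z| := Finset.abs_sum_le_sum_abs _ _
        _ ≤ ∑ _i : Fin m, δ * Z := Finset.sum_le_sum fun i _ => hw (s i)
        _ = δ * Z * m := by simp [mul_comm]
  calc _ ≤ ∑ s : Fin m → Neg t, (∏ i, q (s i)) * (M * δ) :=
        (Finset.abs_sum_le_sum_abs _ _).trans (Finset.sum_le_sum fun s _ => hterm s)
    _ = M * δ := by rw [← Finset.sum_mul, sum_prod_apply_eq_one hsum, one_mul]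

/-- Sampling proportionally to `x`, where `x` approximates `κ` within relative error `η`, gives a
positive distribution whose importance weights for a target proportional to `κ` are within relative
error `4 η` of the total mass of the target. -/
theorem importance_weight_bound {ι : Type} [Fintype ι] [Nonempty ι] {x κ e : ι → ℝ} {η a : ℝ}
    (hη0 : 0 ≤ η) (hη : η ≤ 1 / 2) (ha : 0 < a) (hκ : ∀ i, 0 < κ i) (he : ∀ i, e i = a * κ i)
    (hx : ∀ i, |x i - κ i| ≤ η * κ i) :
    IsPosDistribution (fun i => x i / ∑ j, x j) ∧
      ∀ i, |e i / (x i / ∑ j, x j) - ∑ j, e j| ≤ 4 * η * ∑ j, e j := by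
  have hxl : ∀ i, κ i ≤ 2 * x i := fun i => by
    have h1 := (abs_le.1 (hx i)).1
    have h2 : η * κ i ≤ 1 / 2 * κ i := mul_le_mul_of_nonneg_right hη (hκ i).le
    linarith
  have hxpos : ∀ i, 0 < x i := fun i => by linarith [hxl i, hκ i]
  have hS : 0 < ∑ j, x j := Finset.sum_pos (fun i _ => hxpos i) Finset.univ_nonempty
  have hT : 0 < ∑ j, κ j := Finset.sum_pos (fun i _ => hκ i) Finset.univ_nonempty
  refine ⟨⟨fun i => div_pos (hxpos i) hS, by rw [← Finset.sum_div, div_self hS.ne']⟩, fun i => ?_⟩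
  have hST : |∑ j, x j - ∑ j, κ j| ≤ η * ∑ j, κ j := by
    rw [← Finset.sum_sub_distrib, Finset.mul_sum]
    exact (Finset.abs_sum_le_sum_abs _ _).trans (Finset.sum_le_sum fun j _ => hx j)
  have hZ : ∑ j, e j = a * ∑ j, κ j := by simp only [he, Finset.mul_sum]
  rw [hZ, he]
  set S := ∑ j, x j
  set T := ∑ j, κ j
  have hxi := hxpos i
  have hid : a * κ i / (x i / S) - a * T = a * (κ i * (S - T) + T * (κ i - x i)) / x i := by
    field_simp
    ring
  rw [hid, abs_div, abs_of_pos hxi, div_le_iff₀ hxi, abs_mul, abs_of_pos ha]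
  calc a * |κ i * (S - T) + T * (κ i - x i)| ≤ a * (κ i * (η * T) + T * (η * κ i)) := by
        refine mul_le_mul_of_nonneg_left ((abs_add_le _ _).trans ?_) ha.le
        rw [abs_mul, abs_mul, abs_of_pos (hκ i), abs_of_pos hT, abs_sub_comm (κ i)]
        exact add_le_add (mul_le_mul_of_nonneg_left hST (hκ i).le)
          (mul_le_mul_of_nonneg_left (hx i) hT.le)
    _ = 2 * (a * η * T) * κ i := by ring
    _ ≤ 2 * (a * η * T) * (2 * x i) := by
        gcongr
        exact hxl i
    _ = _ := by ring

theorem sum_eq_add_sum_neg {n : ℕ} (t : Fin n) (f : Fin n → ℝ) :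
    ∑ i, f i = f t + ∑ j : Neg t, f j := by
  exact Fintype.sum_eq_add_sum_subtype_ne f t

theorem gradient_fullLoss_apply {n P : ℕ} (t : Fin n) {f : Fin n → Vec P → ℝ} {θ : Vec P}
    (hf : ∀ i, DifferentiableAt ℝ (f i) θ) (k : Fin P) :
    gradient (fun ϑ => fullLoss t (fun i => f i ϑ)) θ k =
      -gradient (f t) θ k +
        (Real.exp (f t θ) * gradient (f t) θ k +
          ∑ j : Neg t, Real.exp (f j θ) * gradient (f j) θ k) /
        (Real.exp (f t θ) + ∑ j : Neg t, Real.exp (f j θ)) := by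
  have hpos : 0 < ∑ i, Real.exp (f i θ) :=
    Finset.sum_pos (fun i _ => Real.exp_pos _) ⟨t, Finset.mem_univ t⟩
  have hcoord : ∀ F : Vec P → ℝ, gradient F θ k = fderiv ℝ F θ (EuclideanSpace.single k 1) := by
    intro F
    rw [← inner_gradient_left, EuclideanSpace.inner_single_right]
    simp
  have hd : HasFDerivAt (fun ϑ => fullLoss t (fun i => f i ϑ))
      (-fderiv ℝ (f t) θ + (∑ i, Real.exp (f i θ))⁻¹ •
        ∑ i, Real.exp (f i θ) • fderiv ℝ (f i) θ) θ := by
    unfold fullLoss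
    exact (hf t).hasFDerivAt.neg.add
      ((HasFDerivAt.fun_sum fun i _ => (hf i).hasFDerivAt.exp).log hpos.ne')
  simp only [hcoord, hd.fderiv]
  rw [← sum_eq_add_sum_neg t (fun i => Real.exp (f i θ)),
    ← sum_eq_add_sum_neg t (fun i => Real.exp (f i θ) * fderiv ℝ (f i) θ _)]
  simp [div_eq_inv_mul]

/-! ### Uniform approximation of the kernel -/

theorem measureReal_le_abs_sum_cos_sub_le {d : ℕ} (μ : Measure (Vec d)) [IsProbabilityMeasure μ]
    (D : ℕ) {ε : ℝ} (hε : 0 ≤ ε) (u : Vec d) :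
    (Measure.pi fun _ : Fin D => μ).real
        {w | D * ε ≤ |∑ j, (Real.cos (inner ℝ (w j) u) - ∫ x, Real.cos (inner ℝ x u) ∂μ)|} ≤
      2 * Real.exp (-(D * ε ^ 2) / 2) := by
  rcases Nat.eq_zero_or_pos D with rfl | hD
  · refine measureReal_le_one.trans ?_
    norm_num
  have hD0 : (0 : ℝ) < D := by exact_mod_cast hD
  set X : Vec d → ℝ := fun x => Real.cos (inner ℝ x u) - ∫ x, Real.cos (inner ℝ x u) ∂μ with hX
  have hXm : Measurable X := by fun_prop
  have hsub : HasSubgaussianMGF X 1 μ := by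
    have := hasSubgaussianMGF_of_mem_Icc (μ := μ) (X := fun x : Vec d => Real.cos (inner ℝ x u))
      (a := -1) (b := 1) (by fun_prop)
      (Eventually.of_forall fun x => ⟨Real.neg_one_le_cos _, Real.cos_le_one _⟩)
    convert this using 1
    rw [← NNReal.coe_inj]
    norm_num
  have hsubj : ∀ j : Fin D, HasSubgaussianMGF (fun w : Fin D → Vec d => X (w j)) 1
      (Measure.pi fun _ : Fin D => μ) := fun j => by
    have hmp := measurePreserving_eval (fun _ : Fin D => μ) j
    rw [← hmp.map_eq] at hsub
    exact hsub.of_map hmp.measurable.aemeasurable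
  have hind : iIndepFun (fun (j : Fin D) (w : Fin D → Vec d) => X (w j))
      (Measure.pi fun _ : Fin D => μ) := iIndepFun_pi fun _ => hXm.aemeasurable
  have hind' : iIndepFun (fun (j : Fin D) (w : Fin D → Vec d) => -X (w j))
      (Measure.pi fun _ : Fin D => μ) := iIndepFun_pi (X := fun _ x => -X x)
        fun _ => hXm.neg.aemeasurable
  have hDε : 0 ≤ D * ε := by positivity
  have h1 := HasSubgaussianMGF.measure_sum_ge_le_of_iIndepFun hind (s := Finset.univ)
    (fun j _ => hsubj j) hDε
  have h2 := HasSubgaussianMGF.measure_sum_ge_le_of_iIndepFun hind' (s := Finset.univ)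
    (fun j _ => (hsubj j).neg) hDε
  have hexp : -(D * ε) ^ 2 / (2 * ((∑ _j : Fin D, (1 : NNReal) : NNReal) : ℝ)) =
      -(D * ε ^ 2) / 2 := by
    simp only [Finset.sum_const, Finset.card_univ, Fintype.card_fin, nsmul_eq_mul, mul_one,
      NNReal.coe_natCast]
    field_simp
  rw [hexp] at h1 h2
  calc _ ≤ (Measure.pi fun _ : Fin D => μ).real
          ({w | D * ε ≤ ∑ j, X (w j)} ∪ {w | D * ε ≤ ∑ j, -X (w j)}) := by
        refine measureReal_mono fun w hw => ?_
        simp only [Set.mem_ofPred_eq, le_abs, Set.mem_union, Finset.sum_neg_distrib] at hw ⊢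
        exact hw
    _ ≤ _ := (measureReal_union_le _ _).trans (by linarith)

/-- Markov's inequality for the sum of the norms of `D` independent vectors. -/
theorem measureReal_le_sum_norm_le {d : ℕ} {μ : Measure (Vec d)} [IsProbabilityMeasure μ]
    (hμ : Integrable (fun x : Vec d => ‖x‖) μ) {D : ℕ} (hD : 1 ≤ D) :
    (Measure.pi fun _ : Fin D => μ).real {w | (D : ℝ) ^ 3 ≤ ∑ j, ‖w j‖} ≤
      (∫ x, ‖x‖ ∂μ) / (D : ℝ) ^ 2 := by
  have hD0 : (0 : ℝ) < D := by exact_mod_cast hD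
  have hj : ∀ j : Fin D, Integrable (fun w : Fin D → Vec d => ‖w j‖)
      (Measure.pi fun _ : Fin D => μ) := fun j =>
    (measurePreserving_eval (fun _ : Fin D => μ) j).integrable_comp_of_integrable hμ
  have hi : ∀ j : Fin D, ∫ w : Fin D → Vec d, ‖w j‖ ∂(Measure.pi fun _ : Fin D => μ) =
      ∫ x, ‖x‖ ∂μ := fun j => integral_comp_eval (μ := fun _ : Fin D => μ) hμ.1
  have := mul_meas_ge_le_integral_of_nonneg (μ := Measure.pi fun _ : Fin D => μ)
    (f := fun w => ∑ j, ‖w j‖) (Eventually.of_forall fun w => Finset.sum_nonneg fun j _ =>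
      norm_nonneg _) (integrable_finsetSum _ fun j _ => hj j) ((D : ℝ) ^ 3)
  rw [integral_finsetSum _ fun j _ => hj j] at this
  simp only [hi, Finset.sum_const, Finset.card_univ, Fintype.card_fin, nsmul_eq_mul] at this
  rw [le_div_iff₀ (by positivity)]
  refine le_of_mul_le_mul_left ?_ hD0
  linarith

/-- A grid of mesh `1 / N` gives a net of the ball of radius `2` with at most `(5 N) ^ d`
points. -/
theorem exists_finset_net (d : ℕ) {N : ℕ} (hN : 1 ≤ N) :
    ∃ S : Finset (Vec d), S.card ≤ (5 * N) ^ d ∧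
      ∀ u : Vec d, ‖u‖ ≤ 2 → ∃ v ∈ S, ‖u - v‖ ≤ d / N := by
  classical
  have hN0 : (0 : ℝ) < N := by exact_mod_cast hN
  refine ⟨(Fintype.piFinset fun _ : Fin d => Finset.Icc (-(2 * N : ℤ)) (2 * N)).image
    fun z => WithLp.toLp 2 fun i => (z i : ℝ) / N, ?_, fun u hu => ?_⟩
  · refine Finset.card_image_le.trans ?_
    simp only [Fintype.card_piFinset, Int.card_Icc, Finset.prod_const, Finset.card_univ,
      Fintype.card_fin]
    gcongr
    omega
  · refine ⟨_, Finset.mem_image_of_mem _ (a := fun i => ⌊N * u i⌋) ?_, ?_⟩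
    · rw [Fintype.mem_piFinset]
      intro i
      have hi := abs_le.1 ((PiLp.norm_apply_le u i).trans hu)
      rw [Finset.mem_Icc, Int.le_floor]
      refine ⟨?_, ?_⟩
      · push_cast
        nlinarith
      · have : (⌊N * u i⌋ : ℝ) ≤ 2 * N := (Int.floor_le _).trans (by nlinarith)
        exact_mod_cast this
    · rw [EuclideanSpace.norm_eq]
      refine Real.sqrt_le_iff.2 ⟨by positivity, ?_⟩
      have hle : ∀ i, ‖u i - (⌊N * u i⌋ : ℝ) / N‖ ^ 2 ≤ 1 / (N : ℝ) ^ 2 := fun i => by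
        have h1 := Int.floor_le (N * u i)
        have h2 := Int.lt_floor_add_one (N * u i)
        have : u i - (⌊N * u i⌋ : ℝ) / N = (N * u i - ⌊N * u i⌋) / N := by field_simp
        rw [this, Real.norm_eq_abs, sq_abs, div_pow]
        gcongr
        nlinarith
      calc _ ≤ ∑ _i : Fin d, 1 / (N : ℝ) ^ 2 := Finset.sum_le_sum fun i _ => hle i
        _ = d / (N : ℝ) ^ 2 := by simp [div_eq_mul_inv]
        _ ≤ (d : ℝ) ^ 2 / (N : ℝ) ^ 2 := by
            gcongr
            exact_mod_cast Nat.le_self_pow two_ne_zero d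
        _ = _ := by rw [div_pow]

theorem abs_cos_inner_sub_cos_inner_le {d : ℕ} (w u v : Vec d) :
    |Real.cos (inner ℝ w u) - Real.cos (inner ℝ w v)| ≤ ‖w‖ * ‖u - v‖ := by
  refine (Real.abs_cos_sub_cos_le _ _).trans ?_
  rw [← inner_sub_right]
  exact abs_real_inner_le_norm _ _

/-- The accuracy of the random feature kernel with `D` features on the ball of radius `2`, for
frequencies with mean norm `E`. -/
noncomputable def kernelError (d : ℕ) (E : ℝ) (D : ℕ) : ℝ :=
  1 / √√D + d / D + d * E / (D : ℝ) ^ 3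

theorem kernelError_nonneg (d : ℕ) {E : ℝ} (hE : 0 ≤ E) (D : ℕ) : 0 ≤ kernelError d E D := by
  unfold kernelError
  positivity

theorem tendsto_kernelError (d : ℕ) (E : ℝ) : Tendsto (kernelError d E) atTop (𝓝 0) := by
  have hc : Tendsto (fun D : ℕ => (D : ℝ)) atTop atTop := tendsto_natCast_atTop_atTop
  have h1 : Tendsto (fun D : ℕ => 1 / √√(D : ℝ)) atTop (𝓝 0) :=
    tendsto_const_nhds.div_atTop
      (Real.tendsto_sqrt_atTop.comp (Real.tendsto_sqrt_atTop.comp hc))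
  have h2 : Tendsto (fun D : ℕ => (d : ℝ) / D) atTop (𝓝 0) := tendsto_const_nhds.div_atTop hc
  have h3 : Tendsto (fun D : ℕ => (d * E : ℝ) / (D : ℝ) ^ 3) atTop (𝓝 0) :=
    tendsto_const_nhds.div_atTop ((tendsto_pow_atTop three_ne_zero).comp hc)
  have h := (h1.add h2).add h3
  rw [add_zero, add_zero] at h
  exact h

theorem eventually_net_mul_exp_le (d : ℕ) :
    ∀ᶠ D : ℕ in atTop, ((5 * D ^ 3 : ℕ) : ℝ) ^ d * (2 * Real.exp (-√D / 2)) ≤ 1 / (D : ℝ) ^ 2 := by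
  have hc : Tendsto (fun D : ℕ => √(D : ℝ) / 2) atTop atTop :=
    (Real.tendsto_sqrt_atTop.comp tendsto_natCast_atTop_atTop).atTop_div_const two_pos
  have h := ((Real.tendsto_pow_mul_exp_neg_atTop_nhds_zero (2 * (3 * d + 2))).comp hc).const_mul
    ((5 : ℝ) ^ d * 2 * 4 ^ (3 * d + 2))
  rw [mul_zero] at h
  filter_upwards [h.eventually (ge_mem_nhds one_pos), eventually_ge_atTop 1] with D hD hD1
  have hD0 : (0 : ℝ) < D := by exact_mod_cast hD1
  rw [le_div_iff₀ (by positivity)]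
  refine le_of_eq_of_le ?_ hD
  have hsq : (√(D : ℝ) / 2) ^ 2 = D / 4 := by
    rw [div_pow, Real.sq_sqrt hD0.le]
    norm_num
  simp only [Function.comp_apply, pow_mul, hsq, div_pow]
  rw [neg_div, pow_add (D : ℝ), pow_mul (D : ℝ)]
  push_cast
  rw [mul_pow]
  field_simp

/-- Uniform convergence of random Fourier features on the ball of radius `2`, by a union bound over
a grid of mesh `D⁻³`. Off an event of probability `E / D²` the empirical kernel is
`D²`-Lipschitz, so that the grid controls the whole ball. -/
theorem exists_measure_kernelError_lt_le {d : ℕ} {μ : Measure (Vec d)} [IsProbabilityMeasure μ]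
    (hμ : Integrable (fun x : Vec d => ‖x‖) μ) :
    ∀ᶠ D : ℕ in atTop, (Measure.pi fun _ : Fin D => μ)
      {w | ∃ u : Vec d, ‖u‖ ≤ 2 ∧ kernelError d (∫ x, ‖x‖ ∂μ) D <
        |(∑ j, Real.cos (inner ℝ (w j) u)) / D - ∫ x, Real.cos (inner ℝ x u) ∂μ|} ≤
      ENNReal.ofReal ((1 + ∫ x, ‖x‖ ∂μ) / (D : ℝ) ^ 2) := by
  filter_upwards [eventually_net_mul_exp_le d, eventually_ge_atTop 1] with D hexp hD
  have hD0 : (0 : ℝ) < D := by exact_mod_cast hD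
  set E := ∫ x, ‖x‖ ∂μ with hE
  have hE0 : 0 ≤ E := integral_nonneg fun x => norm_nonneg x
  set κ : Vec d → ℝ := fun u => ∫ x, Real.cos (inner ℝ x u) ∂μ with hκ
  set ν := Measure.pi fun _ : Fin D => μ
  obtain ⟨S, hScard, hS⟩ := exists_finset_net d (N := D ^ 3) (Nat.one_le_pow _ _ hD)
  set ε : ℝ := 1 / √√D with hε
  have hε0 : 0 ≤ ε := by positivity
  have hDε : D * ε ^ 2 = √D := by
    rw [hε, div_pow, Real.sq_sqrt (Real.sqrt_nonneg _), one_pow, mul_one_div, Real.div_sqrt]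
  have hκlip : ∀ u v, |κ u - κ v| ≤ E * ‖u - v‖ := fun u v => by
    have hint : ∀ u : Vec d, Integrable (fun x : Vec d => Real.cos (inner ℝ x u)) μ := fun u =>
      Integrable.of_bound (by fun_prop) 1 (Eventually.of_forall fun x => Real.abs_cos_le_one _)
    rw [hκ, ← integral_sub (hint u) (hint v), hE, ← integral_mul_const]
    refine (abs_integral_le_integral_abs).trans (integral_mono ((hint u).sub (hint v)).abs
      (hμ.mul_const _) fun x => abs_cos_inner_sub_cos_inner_le x u v)
  have hsub : {w : Fin D → Vec d | ∃ u : Vec d, ‖u‖ ≤ 2 ∧ kernelError d E D <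
      |(∑ j, Real.cos (inner ℝ (w j) u)) / D - κ u|} ⊆
      (⋃ v ∈ S, {w | D * ε ≤ |∑ j, (Real.cos (inner ℝ (w j) v) - κ v)|}) ∪
        {w | (D : ℝ) ^ 3 ≤ ∑ j, ‖w j‖} := by
    rintro w ⟨u, hu, hlt⟩
    by_contra hw
    simp only [Set.mem_union, Set.mem_iUnion, Set.mem_ofPred_eq, not_or, not_exists, not_le] at hw
    obtain ⟨hw1, hw2⟩ := hw
    obtain ⟨v, hvS, huv⟩ := hS u hu
    push_cast at huv
    have hv : |(∑ j, Real.cos (inner ℝ (w j) v)) / D - κ v| ≤ ε := by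
      have : (∑ j, Real.cos (inner ℝ (w j) v)) / D - κ v =
          (∑ j, (Real.cos (inner ℝ (w j) v) - κ v)) / D := by
        rw [Finset.sum_sub_distrib, sub_div]
        simp only [Finset.sum_const, Finset.card_univ, Fintype.card_fin, nsmul_eq_mul]
        field_simp
      rw [this, abs_div, abs_of_pos hD0, div_le_iff₀ hD0, mul_comm ε]
      exact (hw1 v hvS).le
    have hemp : |(∑ j, Real.cos (inner ℝ (w j) u)) / D - (∑ j, Real.cos (inner ℝ (w j) v)) / D| ≤
        d / D := by
      rw [← sub_div, ← Finset.sum_sub_distrib, abs_div, abs_of_pos hD0]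
      refine div_le_div_of_nonneg_right ?_ hD0.le
      calc _ ≤ ∑ j, ‖w j‖ * ‖u - v‖ := (Finset.abs_sum_le_sum_abs _ _).trans
            (Finset.sum_le_sum fun j _ => abs_cos_inner_sub_cos_inner_le _ _ _)
        _ = (∑ j, ‖w j‖) * ‖u - v‖ := by rw [Finset.sum_mul]
        _ ≤ (D : ℝ) ^ 3 * (d / (D : ℝ) ^ 3) := by gcongr
        _ = d := by field_simp
    have hker : |κ v - κ u| ≤ d * E / (D : ℝ) ^ 3 := by
      rw [abs_sub_comm]
      refine (hκlip u v).trans ((mul_le_mul_of_nonneg_left huv hE0).trans_eq (by ring))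
    have h3 := abs_sub_le ((∑ j, Real.cos (inner ℝ (w j) u)) / D)
      ((∑ j, Real.cos (inner ℝ (w j) v)) / D) (κ u)
    have h4 := abs_sub_le ((∑ j, Real.cos (inner ℝ (w j) v)) / D) (κ v) (κ u)
    have : kernelError d E D = ε + d / D + d * E / (D : ℝ) ^ 3 := rfl
    linarith
  have hreal : ν.real ((⋃ v ∈ S, {w | D * ε ≤ |∑ j, (Real.cos (inner ℝ (w j) v) - κ v)|}) ∪
        {w | (D : ℝ) ^ 3 ≤ ∑ j, ‖w j‖}) ≤ (1 + E) / (D : ℝ) ^ 2 := by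
    refine (measureReal_union_le _ _).trans ?_
    rw [add_div]
    refine add_le_add ?_ (measureReal_le_sum_norm_le hμ hD)
    calc _ ≤ ∑ v ∈ S, ν.real {w | D * ε ≤ |∑ j, (Real.cos (inner ℝ (w j) v) - κ v)|} :=
          measureReal_biUnion_finset_le _ _
      _ ≤ ∑ _v ∈ S, 2 * Real.exp (-√D / 2) := by
          refine Finset.sum_le_sum fun v _ => ?_
          rw [← hDε]
          exact measureReal_le_abs_sum_cos_sub_le μ D hε0 v
      _ = S.card * (2 * Real.exp (-√D / 2)) := by simp
      _ ≤ ((5 * D ^ 3 : ℕ) : ℝ) ^ d * (2 * Real.exp (-√D / 2)) := by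
          gcongr
          exact_mod_cast hScard
      _ ≤ _ := hexp
  refine (measure_mono hsub).trans ?_
  rw [← ENNReal.ofReal_toReal (measure_ne_top ν _)]
  exact ENNReal.ofReal_le_ofReal hreal

/-! ### The bias of RF-softmax -/

theorem exp_logit_eq {d : ℕ} (τ : ℝ) {h c : Vec d} (hh : ‖h‖ = 1) (hc : ‖c‖ = 1) :
    Real.exp (logit τ h c) = Real.exp τ * Real.exp (-(τ * ‖c - h‖ ^ 2) / 2) := by
  rw [← Real.exp_add, logit, norm_sub_sq_real, hh, hc, real_inner_comm]
  congr 1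
  ring

theorem norm_sub_le_two {d : ℕ} {h c : Vec d} (hh : ‖h‖ = 1) (hc : ‖c‖ = 1) : ‖c - h‖ ≤ 2 :=
  (norm_sub_le c h).trans (by rw [hh, hc]; norm_num)

/-- If the random feature kernel is within `ε` of the Gaussian kernel on the ball of radius `2`,
then RF-softmax is a positive distribution whose importance weights are within relative error
`4 e^{2τ} ε` of the partition function of the negative classes. -/
theorem rfSoftmax_importance_weight_bound {n d D : ℕ} {τ ε : ℝ} (hτ : 0 < τ) (hn : 2 ≤ n)
    (t : Fin n) {w : Fin D → Vec d} {h : Vec d} {c : Fin n → Vec d} (hh : ‖h‖ = 1)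
    (hc : ∀ i, ‖c i‖ = 1) (hε0 : 0 ≤ ε) (hε : Real.exp (2 * τ) * ε ≤ 1 / 2)
    (hw : ∀ u : Vec d, ‖u‖ ≤ 2 →
      |(∑ j, Real.cos (inner ℝ (w j) u)) / D - Real.exp (-(τ * ‖u‖ ^ 2) / 2)| ≤ ε) :
    IsPosDistribution (rfSoftmax t w h c) ∧
      ∀ i : Neg t, |Real.exp (logit τ h (c i)) / rfSoftmax t w h c i -
        ∑ j : Neg t, Real.exp (logit τ h (c j))| ≤
          4 * (Real.exp (2 * τ) * ε) * ∑ j : Neg t, Real.exp (logit τ h (c j)) := by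
  have : Nontrivial (Fin n) := Fin.nontrivial_iff_two_le.2 hn
  obtain ⟨j, hj⟩ := exists_ne t
  have : Nonempty (Neg t) := ⟨⟨j, hj⟩⟩
  refine importance_weight_bound (x := fun i : Neg t => inner ℝ (rffMap w (c i)) (rffMap w h))
    (κ := fun i : Neg t => Real.exp (-(τ * ‖c i - h‖ ^ 2) / 2))
    (e := fun i : Neg t => Real.exp (logit τ h (c i))) (a := Real.exp τ)
    (by positivity) hε (Real.exp_pos τ) (fun i => Real.exp_pos _)
    (fun i => exp_logit_eq τ hh (hc i)) fun i => ?_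
  have hu := norm_sub_le_two hh (hc i)
  rw [inner_rffMap]
  refine (hw _ hu).trans ?_
  -- On the ball of radius `2` the Gaussian kernel is at least `e^{-2τ}`.
  have hone : 1 ≤ Real.exp (2 * τ) * Real.exp (-(τ * ‖c i - h‖ ^ 2) / 2) := by
    rw [← Real.exp_add, Real.one_le_exp_iff]
    have : ‖c i - h‖ ^ 2 ≤ 2 ^ 2 := by gcongr
    nlinarith
  calc ε = ε * 1 := (mul_one ε).symm
    _ ≤ ε * (Real.exp (2 * τ) * Real.exp (-(τ * ‖c i - h‖ ^ 2) / 2)) := by gcongr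
    _ = _ := by ring

end RFSoftmax

theorem corollary1 (d : ℕ) (τ M : ℝ) (hτ : 0 < τ) :
    -- the error terms and constants depend only on `d`, `τ`, `M`:
    -- `a₀, a₁, a₂` are `o_D(1)` and `b₁, b₂` are `o(1/m)`
    ∃ (D₀ : ℕ) (K : ℝ) (a₀ a₁ a₂ b₁ b₂ : ℕ → ℝ),
      Tendsto a₀ atTop (𝓝 0) ∧ Tendsto a₁ atTop (𝓝 0) ∧ Tendsto a₂ atTop (𝓝 0) ∧
      b₁ =o[atTop] (fun m : ℕ => 1 / (m : ℝ)) ∧ b₂ =o[atTop] (fun m : ℕ => 1 / (m : ℝ)) ∧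
      ∀ (D : ℕ), D₀ ≤ D →
      ∀ (n : ℕ), 2 ≤ n → ∀ (t : Fin n)
        -- the input embedding and the class embeddings as functions of `P` model parameters
        (P : ℕ) (h : RFSoftmax.Vec P → RFSoftmax.Vec d)
        (c : Fin n → RFSoftmax.Vec P → RFSoftmax.Vec d) (θ : RFSoftmax.Vec P),
        ‖h θ‖ = 1 → (∀ i, ‖c i θ‖ = 1) →
        (∀ i, DifferentiableAt ℝ (fun ϑ => RFSoftmax.logit τ (h ϑ) (c i ϑ)) θ) →
        -- coordinates of the gradients of the logits are bounded by `M`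
        (∀ i (k : Fin P), |gradient (fun ϑ => RFSoftmax.logit τ (h ϑ) (c i ϑ)) θ k| ≤ M) →
        -- logits, their gradients, the gradient of the full loss, and the vector `g` at `θ`
        let o : Fin n → ℝ := fun i => RFSoftmax.logit τ (h θ) (c i θ)
        let G : Fin n → RFSoftmax.Vec P :=
          fun i => gradient (fun ϑ => RFSoftmax.logit τ (h ϑ) (c i ϑ)) θ
        let gradL : RFSoftmax.Vec P := gradient
          (fun ϑ => RFSoftmax.fullLoss t (fun i => RFSoftmax.logit τ (h ϑ) (c i ϑ))) θ
        let g : RFSoftmax.Vec P := ∑ j : RFSoftmax.Neg t, Real.exp (o j) • G j;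
        -- over the draw of the frequencies with `ν = τ`, the failure probability is `O(1/D²)`
        RFSoftmax.freqLaw d D τ
          {w | ¬ (RFSoftmax.IsPosDistribution (RFSoftmax.rfSoftmax t w (h θ) (fun i => c i θ)) ∧
            ∀ m : ℕ, 1 ≤ m → ∀ k : Fin P,
              let bias : RFSoftmax.Vec P := RFSoftmax.expectedSampledGrad m t o G
                (RFSoftmax.rfSoftmax t w (h θ) (fun i => c i θ)) - gradL;
              -a₀ D ≤ bias k ∧
              bias k ≤ (a₁ D + b₁ m) * g k + (a₂ D + b₂ m))}
          ≤ ENNReal.ofReal (K / (D : ℝ) ^ 2) := by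
  set γ := multivariateGaussian 0 (τ • (1 : Matrix (Fin d) (Fin d) ℝ)) with hγ
  set E := ∫ x, ‖x‖ ∂γ
  have hE0 : 0 ≤ E := integral_nonneg fun x => norm_nonneg x
  have hint : Integrable (fun x : RFSoftmax.Vec d => ‖x‖) γ := IsGaussian.integrable_id.norm
  set δ : ℕ → ℝ := fun D => 4 * (Real.exp (2 * τ) * RFSoftmax.kernelError d E D) with hδ
  have hker := RFSoftmax.tendsto_kernelError d E
  have hη : Tendsto (fun D => Real.exp (2 * τ) * RFSoftmax.kernelError d E D) atTop (𝓝 0) := by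
    simpa using hker.const_mul (Real.exp (2 * τ))
  have ha : Tendsto (fun D => M * δ D) atTop (𝓝 0) := by
    simpa using (hη.const_mul 4).const_mul M
  obtain ⟨D₀, hD₀⟩ := eventually_atTop.1
    ((RFSoftmax.exists_measure_kernelError_lt_le hint).and
      (hη.eventually (ge_mem_nhds (show (0 : ℝ) < 1 / 2 by norm_num))))
  -- The bias is at most `M δ D` uniformly in `m`, so the coefficient of `g` and the terms in `m`
  -- can be `0`.
  refine ⟨D₀, 1 + E, fun D => M * δ D, 0, fun D => M * δ D, 0, 0, ha, tendsto_const_nhds, ha,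
    isLittleO_zero _ _, isLittleO_zero _ _, ?_⟩
  intro D hD n hn t P h c θ hh hc hdiff hbound o G gradL g
  obtain ⟨hprob, hsmall⟩ := hD₀ D hD
  refine (measure_mono ?_).trans hprob
  intro w hw
  by_contra hgood
  refine hw ?_
  simp only [Set.mem_ofPred_eq, not_exists, not_and, not_lt] at hgood
  have hε0 : 0 ≤ RFSoftmax.kernelError d E D :=
    RFSoftmax.kernelError_nonneg d hE0 D
  obtain ⟨hpos, hweight⟩ := RFSoftmax.rfSoftmax_importance_weight_bound (w := w)
    (c := fun i => c i θ) hτ hn t hh hc hε0 hsmall fun u hu => by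
      rw [← RFSoftmax.integral_cos_inner_multivariateGaussian d hτ.le u]
      exact hgood u hu
  refine ⟨hpos, fun m hm k => ?_⟩
  have hbias := RFSoftmax.abs_expectedSampledGrad_sub_le (o := o) (G := G) hpos hm (k := k)
    (M := M) (δ := δ D) (by positivity) (fun i => hbound i k) hweight
  rw [← RFSoftmax.gradient_fullLoss_apply t hdiff k] at hbias
  have hb := abs_le.1 hbias
  refine ⟨hb.1, ?_⟩
  simpa using hb.2
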